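/- Let $A$ be a $3$-dimensional Alexandrov space of nonnegative curvature, that is, a complete geodesic metric space of Hausdorff dimension $3$ in which Toponogov's triangle comparison with the Euclidean plane holds: for all $p,x,y\in A$ and every point $z$ on a minimal geodesic from $x$ to $y$, one has $d(p,z)\ge |p'z'|$, where $p',x',y'\in\mathbb{R}^2$ are the vertices of a triangle with side lengths $d(p,x)$, $d(p,y)$, $d(x,y)$ and $z'$ is the point of the side $x'y'$ at distance $d(x,z)$ from $x'$. For $p\in A$ let $\Sigma_pA$ be the space of directions at $p$, i.e. the metric completion of the set of nonconstant minimal geodesics issuing from $p$, with the angle at $p$ as distance, where geodesics making angle $0$ are identified. Let $\mathbb{S}^2(1/2)$ be the round $2$-sphere of radius $1/2$ with its intrinsic (great circle) distance, and say that $\Sigma_pA$ is not larger than $\mathbb{S}^2(1/2)$, written $\Sigma_pA\le\mathbb{S}^2(1/2)$, if there is a surjective distance-nonincreasing map $\mathbb{S}^2(1/2)\to\Sigma_pA$. Then there are at most four points $p\in A$ with $\Sigma_pA\le\mathbb{S}^2(1/2)$. -/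

import Mathlib

open Filter Topology Set

/-- `γ` restricted to `[0, L]` is a minimal geodesic parametrized by arc length. -/
def IsMinimalGeodesic {A : Type*} [MetricSpace A] (γ : ℝ → A) (L : ℝ) : Prop :=
  ∀ s ∈ Icc 0 L, ∀ t ∈ Icc 0 L, dist (γ s) (γ t) = |s - t|

/-- Complete geodesic spaces satisfying Toponogov's comparison with the Euclidean plane
(point-on-a-side form), i.e. Alexandrov spaces of nonnegative curvature: if `z` lies on a
minimal geodesic from `x` to `y`, then its distance to `p` is at least the distance of the
corresponding points `z'`, `p'` in a Euclidean comparison triangle `p'`, `x'`, `y'`. -/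
structure IsNonnegativelyCurvedAlexandrov (A : Type*) [MetricSpace A] : Prop where
  complete : CompleteSpace A
  exists_geodesic : ∀ x y : A, ∃ γ : ℝ → A,
    IsMinimalGeodesic γ (dist x y) ∧ γ 0 = x ∧ γ (dist x y) = y
  comparison : ∀ p x y z : A, dist x z + dist z y = dist x y →
    ∀ p' x' y' z' : EuclideanSpace ℝ (Fin 2),
      dist p' x' = dist p x → dist p' y' = dist p y → dist x' y' = dist x y →
      dist x' z' = dist x z → dist z' y' = dist z y →
      dist p' z' ≤ dist p z

/-- The angle at `p` of the Euclidean comparison triangle of `p`, `x`, `y`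
(for `x ≠ p` and `y ≠ p`), by the law of cosines. -/
noncomputable def comparisonAngle {A : Type*} [MetricSpace A] (p x y : A) : ℝ :=
  Real.arccos ((dist p x ^ 2 + dist p y ^ 2 - dist x y ^ 2) / (2 * dist p x * dist p y))

/-- A nonconstant minimal geodesic issuing from `p`. -/
structure GeodesicFrom {A : Type*} [MetricSpace A] (p : A) where
  length : ℝ
  length_pos : 0 < length
  curve : ℝ → A
  curve_zero : curve 0 = p
  isMinimalGeodesic : IsMinimalGeodesic curve length

namespace GeodesicFrom

/-- The (upper) angle at `p` between two geodesics issuing from `p`. -/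
noncomputable def angle {A : Type*} [MetricSpace A] {p : A} (c c' : GeodesicFrom p) : ℝ :=
  limsup (fun q : ℝ × ℝ => comparisonAngle p (c.curve q.1) (c'.curve q.2))
    (𝓝[>] (0 : ℝ) ×ˢ 𝓝[>] (0 : ℝ))

theorem dist_curve {A : Type*} [MetricSpace A] {p : A} (c : GeodesicFrom p) {s : ℝ}
    (hs : 0 < s) (hs' : s < c.length) : dist p (c.curve s) = s := by
  have h := c.isMinimalGeodesic 0 ⟨le_rfl, c.length_pos.le⟩ s ⟨hs.le, hs'.le⟩
  rw [c.curve_zero] at h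
  rw [h, zero_sub, abs_neg, abs_of_pos hs]

theorem comparisonAngle_comm {A : Type*} [MetricSpace A] (p x y : A) :
    comparisonAngle p x y = comparisonAngle p y x := by
  unfold comparisonAngle
  rw [dist_comm x y, add_comm (dist p x ^ 2), mul_assoc, mul_assoc, mul_comm (dist p x)]

theorem bddAbove {A : Type*} [MetricSpace A] {p : A} (c c' : GeodesicFrom p) :
    IsBoundedUnder (· ≤ ·) (𝓝[>] (0 : ℝ) ×ˢ 𝓝[>] (0 : ℝ))
      (fun q : ℝ × ℝ => comparisonAngle p (c.curve q.1) (c'.curve q.2)) :=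
  isBoundedUnder_of ⟨Real.pi, fun _ => Real.arccos_le_pi _⟩

theorem bddBelow {A : Type*} [MetricSpace A] {p : A} (c c' : GeodesicFrom p) :
    IsBoundedUnder (· ≥ ·) (𝓝[>] (0 : ℝ) ×ˢ 𝓝[>] (0 : ℝ))
      (fun q : ℝ × ℝ => comparisonAngle p (c.curve q.1) (c'.curve q.2)) :=
  isBoundedUnder_of ⟨0, fun _ => Real.arccos_nonneg _⟩

theorem angle_nonneg {A : Type*} [MetricSpace A] {p : A} (c c' : GeodesicFrom p) :
    0 ≤ angle c c' := by
  refine le_limsup_of_frequently_le ?_ (bddAbove c c')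
  exact (Eventually.of_forall fun _ => Real.arccos_nonneg _).frequently

theorem angle_comm {A : Type*} [MetricSpace A] {p : A} (c c' : GeodesicFrom p) :
    angle c c' = angle c' c := by
  unfold angle
  conv_lhs => rw [Filter.prod_comm]
  simp only [limsup, Filter.map_map]
  congr 2
  funext q
  exact comparisonAngle_comm _ _ _

theorem eventually_small (a : ℝ) (ha : 0 < a) (b : ℝ) (hb : 0 < b) :
    ∀ᶠ q : ℝ × ℝ in 𝓝[>] (0 : ℝ) ×ˢ 𝓝[>] (0 : ℝ), (0 < q.1 ∧ q.1 < a) ∧ (0 < q.2 ∧ q.2 < b) :=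
  Filter.Eventually.prod_mk (pa := fun s => 0 < s ∧ s < a) (pb := fun s => 0 < s ∧ s < b)
    (Ioo_mem_nhdsGT ha) (Ioo_mem_nhdsGT hb)

theorem angle_self {A : Type*} [MetricSpace A] {p : A} (c : GeodesicFrom p) :
    angle c c = 0 := by
  have h : (fun q : ℝ × ℝ => comparisonAngle p (c.curve q.1) (c.curve q.2))
      =ᶠ[𝓝[>] (0 : ℝ) ×ˢ 𝓝[>] (0 : ℝ)] fun _ => (0 : ℝ) := by
    filter_upwards [eventually_small _ c.length_pos _ c.length_pos] with q hq
    obtain ⟨⟨h1, h2⟩, h3, h4⟩ := hq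
    unfold comparisonAngle
    rw [c.dist_curve h1 h2, c.dist_curve h3 h4,
      c.isMinimalGeodesic _ ⟨h1.le, h2.le⟩ _ ⟨h3.le, h4.le⟩, sq_abs]
    have : (q.1 ^ 2 + q.2 ^ 2 - (q.1 - q.2) ^ 2) / (2 * q.1 * q.2) = 1 := by
      field_simp
      ring
    rw [this, Real.arccos_one]
  unfold angle
  rw [limsup_congr h, limsup_const]

theorem exists_planar_point {a b α β : ℝ} (ha : 0 < a) (hb : 0 < b) (hα : 0 < α) (hβ : 0 < β)
    (h : α + β < Real.pi) : ∃ t u v : ℝ, 0 < t ∧ t ≤ max a b ∧ 0 ≤ u ∧ 0 ≤ v ∧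
      u ^ 2 = a ^ 2 + t ^ 2 - 2 * a * t * Real.cos α ∧
      v ^ 2 = t ^ 2 + b ^ 2 - 2 * t * b * Real.cos β ∧
      (u + v) ^ 2 = a ^ 2 + b ^ 2 - 2 * a * b * Real.cos (α + β) := by
  have sα : 0 < Real.sin α := Real.sin_pos_of_pos_of_lt_pi hα (by linarith)
  have sβ : 0 < Real.sin β := Real.sin_pos_of_pos_of_lt_pi hβ (by linarith)
  have sab : 0 < Real.sin (α + β) := Real.sin_pos_of_pos_of_lt_pi (by linarith) h
  have hD : 0 < a * Real.sin α + b * Real.sin β := by positivity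
  have cα := Real.sin_sq_add_cos_sq α
  have cβ := Real.sin_sq_add_cos_sq β
  set D := a * Real.sin α + b * Real.sin β with hDdef
  set t : ℝ := a * b * Real.sin (α + β) / D with ht
  have htD : t * D = a * b * Real.sin (α + β) := by rw [ht]; field_simp
  let X : ℂ := ⟨a * Real.cos α, a * Real.sin α⟩
  let Y : ℂ := ⟨b * Real.cos β, -(b * Real.sin β)⟩
  let T : ℂ := ⟨t, 0⟩
  have hmem : T ∈ segment ℝ X Y := by
    refine ⟨b * Real.sin β / D, a * Real.sin α / D, by positivity, by positivity, ?_, ?_⟩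
    · field_simp
      rw [hDdef]; ring
    · apply Complex.ext
      · simp only [X, Y, T, Complex.add_re, Complex.real_smul, Complex.re_ofReal_mul, ht,
          Real.sin_add]
        field_simp
        ring
      · simp only [X, Y, T, Complex.add_im, Complex.real_smul, Complex.im_ofReal_mul]
        field_simp
        ring
  have nX : ‖X‖ ^ 2 = a ^ 2 := by
    rw [← Complex.normSq_eq_norm_sq, Complex.normSq_apply]
    simp only [X]
    linear_combination a ^ 2 * cα
  have nY : ‖Y‖ ^ 2 = b ^ 2 := by
    rw [← Complex.normSq_eq_norm_sq, Complex.normSq_apply]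
    simp only [Y]
    linear_combination b ^ 2 * cβ
  have nX' : ‖X‖ = a := (sq_eq_sq₀ (norm_nonneg _) ha.le).1 nX
  have nY' : ‖Y‖ = b := (sq_eq_sq₀ (norm_nonneg _) hb.le).1 nY
  have tpos : 0 < t := by positivity
  refine ⟨t, dist X T, dist T Y, tpos, ?_, dist_nonneg, dist_nonneg, ?_, ?_, ?_⟩
  · have h1 : ‖T‖ ≤ max a b := by
      have hc : Convex ℝ (Metric.closedBall (0 : ℂ) (max a b)) := convex_closedBall _ _
      have := hc.segment_subset (x := X) (y := Y) (by simp [nX']) (by simp [nY']) hmem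
      simpa using this
    have h2 : T = (t : ℂ) := rfl
    rw [h2, Complex.norm_real, Real.norm_of_nonneg tpos.le] at h1
    exact h1
  · rw [dist_eq_norm, ← Complex.normSq_eq_norm_sq, Complex.normSq_apply]
    simp only [X, T, Complex.sub_re, Complex.sub_im]
    linear_combination a ^ 2 * cα
  · rw [dist_eq_norm, ← Complex.normSq_eq_norm_sq, Complex.normSq_apply]
    simp only [Y, T, Complex.sub_re, Complex.sub_im]
    linear_combination b ^ 2 * cβ
  · rw [dist_add_dist_of_mem_segment hmem, dist_eq_norm, ← Complex.normSq_eq_norm_sq,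
      Complex.normSq_apply, Real.cos_add]
    simp only [X, Y, Complex.sub_re, Complex.sub_im]
    linear_combination a ^ 2 * cα + b ^ 2 * cβ

theorem angle_triangle {A : Type*} [MetricSpace A] {p : A} (c₁ c₂ c₃ : GeodesicFrom p) :
    angle c₁ c₃ ≤ angle c₁ c₂ + angle c₂ c₃ := by
  by_contra! hlt
  have n12 := angle_nonneg c₁ c₂
  have n23 := angle_nonneg c₂ c₃
  set δ := (angle c₁ c₃ - angle c₁ c₂ - angle c₂ c₃) / 4 with hδ
  have δpos : 0 < δ := by rw [hδ]; linarith
  set α := angle c₁ c₂ + δ with hα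
  set β := angle c₂ c₃ + δ with hβ
  have e12 := eventually_lt_of_limsup_lt (show angle c₁ c₂ < α by linarith) (bddAbove c₁ c₂)
  have e23 := eventually_lt_of_limsup_lt (show angle c₂ c₃ < β by linarith) (bddAbove c₂ c₃)
  have f13 := frequently_lt_of_lt_limsup (bddBelow c₁ c₃).isCoboundedUnder_le
    (show α + β < angle c₁ c₃ by linarith)
  have hb := (nhdsGT_basis (0 : ℝ)).prod_self
  obtain ⟨ε₁, ε₁pos, h12⟩ := hb.eventually_iff.1 e12
  obtain ⟨ε₂, ε₂pos, h23⟩ := hb.eventually_iff.1 e23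
  have εpos : 0 < min (min ε₁ ε₂) c₂.length := lt_min (lt_min ε₁pos ε₂pos) c₂.length_pos
  obtain ⟨⟨a, b⟩, hfr, ⟨⟨a0, a1⟩, b0, b1⟩, ⟨-, a2⟩, -, b2⟩ := (f13.and_eventually
    ((eventually_small _ c₁.length_pos _ c₃.length_pos).and
      (eventually_small _ εpos _ εpos))).exists
  simp only at hfr a0 a1 b0 b1 a2 b2
  have hπ : α + β < Real.pi := hfr.trans_le (Real.arccos_le_pi _)
  obtain ⟨t, u, v, t0, t1, u0, v0, hu, hv, huv⟩ :=
    exists_planar_point a0 b0 (by linarith : 0 < α) (by linarith : 0 < β) hπ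
  have t2 : t < min (min ε₁ ε₂) c₂.length := t1.trans_lt (max_lt a2 b2)
  obtain ⟨t3, t4⟩ := lt_min_iff.1 t2
  obtain ⟨t5, t6⟩ := lt_min_iff.1 t3
  have a3 := (lt_min_iff.1 (lt_min_iff.1 a2).1)
  have b3 := (lt_min_iff.1 (lt_min_iff.1 b2).1)
  have k12 := @h12 (a, t) ⟨⟨a0, a3.1⟩, t0, t5⟩
  have k23 := @h23 (t, b) ⟨⟨t0, t6⟩, b0, b3.2⟩
  simp only [comparisonAngle, c₁.dist_curve a0 a1, c₂.dist_curve t0 t4,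
    c₃.dist_curve b0 b1] at k12 k23 hfr
  have key : ∀ x θ : ℝ, 0 < θ → θ < Real.pi → Real.arccos x < θ → Real.cos θ < x := by
    intro x θ h1 h2 h3
    by_contra! h4
    have := Real.arccos_le_arccos h4
    rw [Real.arccos_cos h1.le h2.le] at this
    linarith
  have key' : ∀ x θ : ℝ, 0 < θ → θ < Real.pi → θ < Real.arccos x → x < Real.cos θ := by
    intro x θ h1 h2 h3
    by_contra! h4
    have := Real.arccos_le_arccos h4
    rw [Real.arccos_cos h1.le h2.le] at this
    linarith
  have m12 := key _ _ (by linarith) (by linarith) k12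
  have m23 := key _ _ (by linarith) (by linarith) k23
  have m13 := key' _ _ (by linarith) (by linarith) hfr
  rw [lt_div_iff₀ (by positivity)] at m12 m23
  rw [div_lt_iff₀ (by positivity)] at m13
  have d12 : dist (c₁.curve a) (c₂.curve t) < u := lt_of_pow_lt_pow_left₀ 2 u0 (by linarith)
  have d23 : dist (c₂.curve t) (c₃.curve b) < v := lt_of_pow_lt_pow_left₀ 2 v0 (by linarith)
  have d13 : u + v < dist (c₁.curve a) (c₃.curve b) :=
    lt_of_pow_lt_pow_left₀ 2 dist_nonneg (by linarith)
  have := dist_triangle (c₁.curve a) (c₂.curve t) (c₃.curve b)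
  linarith

noncomputable instance {A : Type*} [MetricSpace A] (p : A) :
    PseudoMetricSpace (GeodesicFrom p) where
  dist := angle
  dist_self := angle_self
  dist_comm := angle_comm
  dist_triangle := angle_triangle

end GeodesicFrom

/-- The space of directions at `p`: geodesics issuing from `p`, with the angle as distance, are
identified if their angle is zero, and the resulting metric space is completed. (The Hausdorff
completion `UniformSpace.Completion` of a pseudometric space performs both steps.) -/
abbrev SpaceOfDirections {A : Type*} [MetricSpace A] (p : A) : Type _ :=
  UniformSpace.Completion (GeodesicFrom p)

/-- The intrinsic (great circle) distance on the round 2-sphere of radius `r` in `ℝ³`. -/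
noncomputable def sphereDist {r : ℝ} (x y : Metric.sphere (0 : EuclideanSpace ℝ (Fin 3)) r) : ℝ :=
  r * InnerProductGeometry.angle (x : EuclideanSpace ℝ (Fin 3)) (y : EuclideanSpace ℝ (Fin 3))

/-- `Y` is not larger than the round 2-sphere of radius `r`: there is a distance nonincreasing
map from the sphere onto `Y`. -/
def NotLargerThanSphere (Y : Type*) [MetricSpace Y] (r : ℝ) : Prop :=
  ∃ f : Metric.sphere (0 : EuclideanSpace ℝ (Fin 3)) r → Y,
    Function.Surjective f ∧ ∀ x y, dist (f x) (f y) ≤ sphereDist x y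

/-!
Toponogov's comparison gives that the angle between two geodesics is at least the comparison angle
of their endpoints (`comparisonAngle_le_angle`). If the space of directions at `p` is not larger
than the sphere of radius `1/2`, then the comparison angles at `p` are therefore at most the
spherical distances of preimages of the directions from `p` towards the other points
(`exists_comparisonAngle_le_of_notLargerThanSphere`). Three points of that sphere have perimeter at
most `π`, so that any three points seen from `p` have pairwise comparison angles adding up to at
most `π`.

Suppose there are five such points. They form ten triangles, each with comparison angles adding up
to `π`. A vertex together with three of the other four points gives a perimeter, and each
comparison angle occurs in two of these twenty perimeters. The perimeters thus add up to `20 π`, and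
since none exceeds `π`, all of them are equal to `π` (`perimeter_eq_pi_of_five`). At each vertex the
preimages of the four directions are then four vectors of `ℝ³`, any three of which span angles
adding up to `2π`. This makes opposite angles equal, and the linear dependence of four vectors of
`ℝ³` makes one pair antipodal (`exists_angle_eq_pi_of_perimeters`); the complementary pair is then
antipodal as well. So for every two of the five points `p`, `q` there is a third one `r` with
comparison angle `π / 2` at `p` between `q` and `r`. For `p` and `q` at maximal distance this
contradicts `d(q, r)² = d(p, q)² + d(p, r)²`.
-/

open InnerProductGeometry EuclideanGeometry

/-! ### Comparison triangles -/

theorem comparisonAngle_eq_angle {A : Type*} [MetricSpace A] {p x y : A}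
    {p' x' y' : EuclideanSpace ℝ (Fin 2)} (hx : dist p' x' = dist p x)
    (hy : dist p' y' = dist p y) (hxy : dist x' y' = dist x y) :
    comparisonAngle p x y = ∠ x' p' y' := by
  unfold comparisonAngle EuclideanGeometry.angle InnerProductGeometry.angle
  rw [← hx, ← hy, ← hxy, vsub_eq_sub, vsub_eq_sub,
    real_inner_eq_norm_mul_self_add_norm_mul_self_sub_norm_sub_mul_self_div_two,
    sub_sub_sub_cancel_right, dist_comm p' x', dist_comm p' y', dist_eq_norm, dist_eq_norm,
    dist_eq_norm, div_div, ← mul_assoc, sq, sq, sq]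

theorem exists_comparison_triangle {A : Type*} [MetricSpace A] {p x y : A} (hx : x ≠ p)
    (hy : y ≠ p) : ∃ p' x' y' : EuclideanSpace ℝ (Fin 2),
      dist p' x' = dist p x ∧ dist p' y' = dist p y ∧ dist x' y' = dist x y := by
  have ha : 0 < dist p x := dist_pos.2 hx.symm
  have hb : 0 < dist p y := dist_pos.2 hy.symm
  have t1 := dist_triangle p x y
  have t2 := dist_triangle p y x
  have t3 := dist_triangle x p y
  rw [dist_comm y x] at t2
  rw [dist_comm x p] at t3
  set a := dist p x
  set b := dist p y
  set d := dist x y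
  have hd : 0 ≤ d := dist_nonneg
  have hcos : Real.cos (comparisonAngle p x y) = (a ^ 2 + b ^ 2 - d ^ 2) / (2 * a * b) := by
    refine Real.cos_arccos ?_ ?_
    · rw [le_div_iff₀ (by positivity)]
      nlinarith
    · rw [div_le_iff₀ (by positivity)]
      nlinarith [mul_nonneg (sub_nonneg.2 t1) (sub_nonneg.2 t2)]
  have hsc := Real.sin_sq_add_cos_sq (comparisonAngle p x y)
  have key : 2 * a * b * Real.cos (comparisonAngle p x y) = a ^ 2 + b ^ 2 - d ^ 2 := by
    rw [hcos]
    field_simp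
  set θ := comparisonAngle p x y
  refine ⟨0, !₂[a * Real.cos θ, a * Real.sin θ], !₂[b, 0], ?_, ?_, ?_⟩
  · rw [dist_zero_left, EuclideanSpace.norm_eq, Real.sqrt_eq_iff_eq_sq (by positivity) ha.le]
    simp [Fin.sum_univ_two]
    linear_combination a ^ 2 * hsc
  · rw [dist_zero_left, EuclideanSpace.norm_eq, Real.sqrt_eq_iff_eq_sq (by positivity) hb.le]
    simp [Fin.sum_univ_two]
  · rw [EuclideanSpace.dist_eq, Real.sqrt_eq_iff_eq_sq (by positivity) hd]
    simp [Fin.sum_univ_two, Real.dist_eq]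
    linear_combination a ^ 2 * hsc - key

theorem comparisonAngle_add_comparisonAngle_add_comparisonAngle {A : Type*} [MetricSpace A]
    {x y z : A} (hxy : x ≠ y) (hxz : x ≠ z) :
    comparisonAngle x y z + comparisonAngle y x z + comparisonAngle z x y = Real.pi := by
  obtain ⟨x', y', z', h1, h2, h3⟩ := exists_comparison_triangle hxy.symm hxz.symm
  have hne : y' ≠ x' := fun h => hxy (dist_eq_zero.1 (by rw [← h1, h, dist_self]))
  have h := angle_add_angle_add_angle_eq_pi z' hne
  rw [comparisonAngle_eq_angle h1 h2 h3,
    comparisonAngle_eq_angle (by rw [dist_comm, h1, dist_comm]) h3 h2,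
    comparisonAngle_eq_angle (by rw [dist_comm, h2, dist_comm]) (by rw [dist_comm, h3, dist_comm])
      h1, EuclideanGeometry.angle_comm y' x' z']
  rw [EuclideanGeometry.angle_comm y' z' x'] at h
  linarith

/-! ### Monotonicity of comparison angles -/

/-- Moving `y` towards `p` along a minimal geodesic does not decrease the comparison angle at `p`:
this is the comparison axiom applied to the triangle `x`, `p`, `y`. -/
theorem comparisonAngle_le_of_between {A : Type*} [MetricSpace A]
    (hA : IsNonnegativelyCurvedAlexandrov A) {p x y z : A} (hx : x ≠ p) (hy : y ≠ p) (hz : z ≠ p)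
    (h : dist p z + dist z y = dist p y) : comparisonAngle p x y ≤ comparisonAngle p x z := by
  obtain ⟨p', x', y', h1, h2, h3⟩ := exists_comparison_triangle hx hy
  have hb : 0 < dist p y := dist_pos.2 hy.symm
  have ht : 0 < dist p z := dist_pos.2 hz.symm
  set r := dist p z / dist p y with hr
  have hr0 : 0 < r := by positivity
  have hrb : r * dist p y = dist p z := by rw [hr]; field_simp
  have hr1 : 0 ≤ 1 - r := by
    rw [hr, sub_nonneg, div_le_one hb]
    linarith [dist_nonneg (x := z) (y := y)]
  set z' := AffineMap.lineMap p' y' r with hz'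
  have k1 : dist p' z' = dist p z := by
    rw [hz', dist_left_lineMap, Real.norm_of_nonneg hr0.le, h2, hrb]
  have k2 : dist z' y' = dist z y := by
    rw [hz', dist_lineMap_right, Real.norm_of_nonneg hr1, h2]
    linarith
  have hcomp : dist x' z' ≤ dist x z :=
    hA.comparison x p y z h x' p' y' z' (by rw [dist_comm, h1, dist_comm]) h3 h2 k1 k2
  have hangle : ∠ x' p' y' = ∠ x' p' z' := by
    unfold EuclideanGeometry.angle
    rw [hz', AffineMap.lineMap_vsub_left, InnerProductGeometry.angle_smul_right_of_pos _ _ hr0]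
  rw [comparisonAngle_eq_angle h1 h2 h3, hangle,
    ← comparisonAngle_eq_angle (p := p') (x := x') (y := z') rfl rfl rfl]
  unfold comparisonAngle
  rw [h1, k1]
  refine Real.arccos_le_arccos ?_
  gcongr

theorem comparisonAngle_le_angle {A : Type*} [MetricSpace A]
    (hA : IsNonnegativelyCurvedAlexandrov A) {p : A} (c c' : GeodesicFrom p) :
    comparisonAngle p (c.curve c.length) (c'.curve c'.length) ≤ GeodesicFrom.angle c c' := by
  refine le_limsup_of_frequently_le ?_ (GeodesicFrom.bddAbove c c')
  refine Eventually.frequently ?_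
  filter_upwards [GeodesicFrom.eventually_small _ c.length_pos _ c'.length_pos] with q hq
  obtain ⟨⟨a0, a1⟩, b0, b1⟩ := hq
  have hend : ∀ c : GeodesicFrom p, c.curve c.length ≠ p ∧ dist p (c.curve c.length) = c.length := by
    intro c
    have h := c.isMinimalGeodesic 0 ⟨le_rfl, c.length_pos.le⟩ _ ⟨c.length_pos.le, le_rfl⟩
    rw [c.curve_zero, zero_sub, abs_neg, abs_of_pos c.length_pos] at h
    exact ⟨(dist_pos.1 (c.length_pos.trans_eq h.symm)).symm, h⟩
  have hmid : ∀ (c : GeodesicFrom p) {s : ℝ}, 0 < s → s < c.length → c.curve s ≠ p ∧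
      dist p (c.curve s) + dist (c.curve s) (c.curve c.length) = dist p (c.curve c.length) := by
    intro c s hs hs'
    have h := c.dist_curve hs hs'
    refine ⟨(dist_pos.1 (hs.trans_eq h.symm)).symm, ?_⟩
    rw [h, (hend c).2, c.isMinimalGeodesic s ⟨hs.le, hs'.le⟩ _ ⟨c.length_pos.le, le_rfl⟩,
      abs_of_neg (by linarith)]
    ring
  obtain ⟨m1, m2⟩ := hmid c a0 a1
  obtain ⟨n1, n2⟩ := hmid c' b0 b1
  calc comparisonAngle p (c.curve c.length) (c'.curve c'.length)
      ≤ comparisonAngle p (c.curve c.length) (c'.curve q.2) :=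
        comparisonAngle_le_of_between hA (hend c).1 (hend c').1 n1 n2
    _ = comparisonAngle p (c'.curve q.2) (c.curve c.length) :=
        GeodesicFrom.comparisonAngle_comm _ _ _
    _ ≤ comparisonAngle p (c'.curve q.2) (c.curve q.1) :=
        comparisonAngle_le_of_between hA n1 (hend c).1 m1 m2
    _ = comparisonAngle p (c.curve q.1) (c'.curve q.2) :=
        GeodesicFrom.comparisonAngle_comm _ _ _

theorem exists_comparisonAngle_le_of_notLargerThanSphere {A : Type*} [MetricSpace A]
    (hA : IsNonnegativelyCurvedAlexandrov A) {p : A} {r : ℝ}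
    (hp : NotLargerThanSphere (SpaceOfDirections p) r) :
    ∃ u : {x // x ≠ p} → EuclideanSpace ℝ (Fin 3), (∀ x, ‖u x‖ = r) ∧
      ∀ x y : {x // x ≠ p}, comparisonAngle p x y ≤ r * InnerProductGeometry.angle (u x) (u y) := by
  obtain ⟨f, hf, hdist⟩ := hp
  have hc : ∀ x : {x // x ≠ p}, ∃ c : GeodesicFrom p, c.curve c.length = x := by
    rintro ⟨x, hx⟩
    obtain ⟨γ, h1, h2, h3⟩ := hA.exists_geodesic p x
    exact ⟨⟨dist p x, dist_pos.2 hx.symm, γ, h2, h1⟩, h3⟩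
  choose c hc using hc
  choose u hu using fun x => hf (c x : SpaceOfDirections p)
  refine ⟨fun x => u x, fun x => mem_sphere_zero_iff_norm.1 (u x).2, fun x y => ?_⟩
  have h := hdist (u x) (u y)
  rw [hu, hu, UniformSpace.Completion.dist_eq] at h
  calc comparisonAngle p x y = comparisonAngle p ((c x).curve (c x).length)
        ((c y).curve (c y).length) := by rw [hc, hc]
    _ ≤ GeodesicFrom.angle (c x) (c y) := comparisonAngle_le_angle hA _ _
    _ ≤ _ := h

/-! ### Angles between vectors of `ℝ³` -/

theorem angle_add_angle_add_angle_le_two_pi {V : Type*} [NormedAddCommGroup V]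
    [InnerProductSpace ℝ V] (x y z : V) :
    InnerProductGeometry.angle x y + InnerProductGeometry.angle y z +
      InnerProductGeometry.angle x z ≤ 2 * Real.pi := by
  have h := InnerProductGeometry.angle_le_angle_add_angle x (-y) z
  rw [InnerProductGeometry.angle_neg_left, InnerProductGeometry.angle_neg_right] at h
  linarith

/-- The left side is an eigenvalue of the Gram matrix of four unit vectors whose pairs of opposite
angles are `a`, `b` and `c`; by symmetry this covers the eigenvalues of the three nontrivial
characters of the Klein four-group. -/
theorem one_add_cos_sub_cos_sub_cos_eq {a b c : ℝ} (h : a + b + c = 2 * Real.pi) :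
    1 + Real.cos a - Real.cos b - Real.cos c =
      4 * Real.cos (a / 2) * Real.sin (b / 2) * Real.sin (c / 2) := by
  have ha : Real.cos a = Real.cos (2 * (b / 2) + 2 * (c / 2)) := by
    rw [← Real.cos_two_pi_sub]; congr 1; linarith
  have ha' : Real.cos (a / 2) = -Real.cos (b / 2 + c / 2) := by
    rw [← Real.cos_pi_sub]; congr 1; linarith
  have hb : Real.cos b = Real.cos (2 * (b / 2)) := by congr 1; ring
  have hc : Real.cos c = Real.cos (2 * (c / 2)) := by congr 1; ring
  rw [ha, ha', hb, hc]
  simp only [Real.cos_add, Real.cos_two_mul, Real.sin_two_mul]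
  have h1 := Real.sin_sq_add_cos_sq (b / 2)
  have h2 := Real.sin_sq_add_cos_sq (c / 2)
  linear_combination (-4 + 4 * Real.cos (c / 2) ^ 2) * h1 - 4 * Real.sin (b / 2) ^ 2 * h2

/-- The eigenvalue, for the same Gram matrix, of the trivial character. -/
theorem one_add_cos_add_cos_add_cos_eq {a b c : ℝ} (h : a + b + c = 2 * Real.pi) :
    1 + Real.cos a + Real.cos b + Real.cos c =
      -4 * Real.cos (a / 2) * Real.cos (b / 2) * Real.cos (c / 2) := by
  have ha : Real.cos a = Real.cos (2 * (b / 2) + 2 * (c / 2)) := by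
    rw [← Real.cos_two_pi_sub]; congr 1; linarith
  have ha' : Real.cos (a / 2) = -Real.cos (b / 2 + c / 2) := by
    rw [← Real.cos_pi_sub]; congr 1; linarith
  have hb : Real.cos b = Real.cos (2 * (b / 2)) := by congr 1; ring
  have hc : Real.cos c = Real.cos (2 * (c / 2)) := by congr 1; ring
  rw [ha, ha', hb, hc]
  simp only [Real.cos_add, Real.cos_two_mul, Real.sin_two_mul]
  ring

theorem eq_pi_of_cos_half_eq_zero {a : ℝ} (h0 : 0 ≤ a) (h1 : a ≤ Real.pi)
    (h : Real.cos (a / 2) = 0) : a = Real.pi := by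
  by_contra hne
  have := lt_of_le_of_ne h1 hne
  exact (Real.cos_pos_of_mem_Ioo ⟨by linarith, by linarith⟩).ne' h

theorem eq_zero_of_sin_half_eq_zero {a : ℝ} (h0 : 0 ≤ a) (h1 : a ≤ Real.pi)
    (h : Real.sin (a / 2) = 0) : a = 0 := by
  by_contra hne
  have := lt_of_le_of_ne h0 (Ne.symm hne)
  exact (Real.sin_pos_of_pos_of_lt_pi (by linarith) (by linarith)).ne' h

theorem eq_pi_of_gram_eigenvalue_eq_zero {a b c : ℝ} (ha0 : 0 ≤ a) (ha : a ≤ Real.pi)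
    (hb0 : 0 ≤ b) (hb : b ≤ Real.pi) (hc0 : 0 ≤ c) (hc : c ≤ Real.pi)
    (h : a + b + c = 2 * Real.pi) (h0 : 1 + Real.cos a - Real.cos b - Real.cos c = 0) :
    a = Real.pi := by
  rw [one_add_cos_sub_cos_sub_cos_eq h] at h0
  simp only [mul_eq_zero, OfNat.ofNat_ne_zero, false_or] at h0
  rcases h0 with (h0 | h0) | h0
  · exact eq_pi_of_cos_half_eq_zero ha0 ha h0
  · linarith [eq_zero_of_sin_half_eq_zero hb0 hb h0]
  · linarith [eq_zero_of_sin_half_eq_zero hc0 hc h0]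

/-- Four vectors of equal length in `ℝ³`, any three of which span angles adding up to `2π`, have
equal opposite angles, and their Gram matrix has the characters of the Klein four-group as
eigenvectors. As the matrix is singular, an eigenvalue vanishes. -/
theorem exists_angle_eq_pi_of_perimeters {r : ℝ} (hr : r ≠ 0)
    {u₁ u₂ u₃ u₄ : EuclideanSpace ℝ (Fin 3)}
    (n₁ : ‖u₁‖ = r) (n₂ : ‖u₂‖ = r) (n₃ : ‖u₃‖ = r) (n₄ : ‖u₄‖ = r)
    (h₁₂₃ : InnerProductGeometry.angle u₁ u₂ + InnerProductGeometry.angle u₂ u₃ +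
      InnerProductGeometry.angle u₁ u₃ = 2 * Real.pi)
    (h₁₂₄ : InnerProductGeometry.angle u₁ u₂ + InnerProductGeometry.angle u₂ u₄ +
      InnerProductGeometry.angle u₁ u₄ = 2 * Real.pi)
    (h₁₃₄ : InnerProductGeometry.angle u₁ u₃ + InnerProductGeometry.angle u₃ u₄ +
      InnerProductGeometry.angle u₁ u₄ = 2 * Real.pi)
    (h₂₃₄ : InnerProductGeometry.angle u₂ u₃ + InnerProductGeometry.angle u₃ u₄ +
      InnerProductGeometry.angle u₂ u₄ = 2 * Real.pi) :
    InnerProductGeometry.angle u₁ u₂ = Real.pi ∨ InnerProductGeometry.angle u₁ u₃ = Real.pi ∨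
      InnerProductGeometry.angle u₁ u₄ = Real.pi := by
  have hdep : ¬ LinearIndependent ℝ ![u₁, u₂, u₃, u₄] := fun h => by
    simpa using h.fintype_card_le_finrank
  obtain ⟨g, hg, hg0⟩ := Fintype.not_linearIndependent_iff.1 hdep
  simp only [Fin.sum_univ_four, Matrix.cons_val] at hg
  have e₃₄ : InnerProductGeometry.angle u₃ u₄ = InnerProductGeometry.angle u₁ u₂ := by linarith
  have e₂₄ : InnerProductGeometry.angle u₂ u₄ = InnerProductGeometry.angle u₁ u₃ := by linarith
  have e₂₃ : InnerProductGeometry.angle u₂ u₃ = InnerProductGeometry.angle u₁ u₄ := by linarith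
  have inner_eq : ∀ {x y : EuclideanSpace ℝ (Fin 3)}, ‖x‖ = r → ‖y‖ = r →
      inner ℝ x y = r ^ 2 * Real.cos (InnerProductGeometry.angle x y) := by
    intro x y hx hy
    rw [← InnerProductGeometry.cos_angle_mul_norm_mul_norm, hx, hy]
    ring
  have self_eq : ∀ {x : EuclideanSpace ℝ (Fin 3)}, ‖x‖ = r → inner ℝ x x = r ^ 2 := by
    intro x hx
    rw [real_inner_self_eq_norm_sq, hx]
  have r₁ := congrArg (inner ℝ u₁) hg
  have r₂ := congrArg (inner ℝ u₂) hg
  have r₃ := congrArg (inner ℝ u₃) hg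
  have r₄ := congrArg (inner ℝ u₄) hg
  simp only [inner_add_right, inner_smul_right, inner_zero_right, self_eq n₁, self_eq n₂,
    self_eq n₃, self_eq n₄, inner_eq n₁ n₂, inner_eq n₁ n₃, inner_eq n₁ n₄, inner_eq n₂ n₁,
    inner_eq n₂ n₃, inner_eq n₂ n₄, inner_eq n₃ n₁, inner_eq n₃ n₂, inner_eq n₃ n₄,
    inner_eq n₄ n₁, inner_eq n₄ n₂, inner_eq n₄ n₃, InnerProductGeometry.angle_comm u₂ u₁,
    InnerProductGeometry.angle_comm u₃ u₁, InnerProductGeometry.angle_comm u₄ u₁,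
    InnerProductGeometry.angle_comm u₃ u₂, InnerProductGeometry.angle_comm u₄ u₂,
    InnerProductGeometry.angle_comm u₄ u₃, e₃₄, e₂₄, e₂₃] at r₁ r₂ r₃ r₄
  have habc : InnerProductGeometry.angle u₁ u₂ + InnerProductGeometry.angle u₁ u₃ +
      InnerProductGeometry.angle u₁ u₄ = 2 * Real.pi := by linarith
  have a0 := InnerProductGeometry.angle_nonneg u₁ u₂
  have b0 := InnerProductGeometry.angle_nonneg u₁ u₃
  have c0 := InnerProductGeometry.angle_nonneg u₁ u₄
  have a1 := InnerProductGeometry.angle_le_pi u₁ u₂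
  have b1 := InnerProductGeometry.angle_le_pi u₁ u₃
  have c1 := InnerProductGeometry.angle_le_pi u₁ u₄
  clear * - r₁ r₂ r₃ r₄ habc a0 b0 c0 a1 b1 c1 hg0 hr
  generalize InnerProductGeometry.angle u₁ u₂ = a at *
  generalize InnerProductGeometry.angle u₁ u₃ = b at *
  generalize InnerProductGeometry.angle u₁ u₄ = c at *
  by_contra! hne
  obtain ⟨ha, hb, hc⟩ := hne
  have hr2 : r ^ 2 ≠ 0 := pow_ne_zero 2 hr
  -- The eigenvalues are nonzero, so the coefficients of `g` along the four characters vanish.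
  have m₀ : 1 + Real.cos a + Real.cos b + Real.cos c ≠ 0 := by
    rw [one_add_cos_add_cos_add_cos_eq habc]
    refine mul_ne_zero (mul_ne_zero (mul_ne_zero (by norm_num) ?_) ?_) ?_
    · exact fun h => ha (eq_pi_of_cos_half_eq_zero a0 a1 h)
    · exact fun h => hb (eq_pi_of_cos_half_eq_zero b0 b1 h)
    · exact fun h => hc (eq_pi_of_cos_half_eq_zero c0 c1 h)
  have m₁ : 1 + Real.cos a - Real.cos b - Real.cos c ≠ 0 := fun h =>
    ha (eq_pi_of_gram_eigenvalue_eq_zero a0 a1 b0 b1 c0 c1 habc h)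
  have m₂ : 1 + Real.cos b - Real.cos a - Real.cos c ≠ 0 := fun h =>
    hb (eq_pi_of_gram_eigenvalue_eq_zero b0 b1 a0 a1 c0 c1 (by linarith) h)
  have m₃ : 1 + Real.cos c - Real.cos a - Real.cos b ≠ 0 := fun h =>
    hc (eq_pi_of_gram_eigenvalue_eq_zero c0 c1 a0 a1 b0 b1 (by linarith) h)
  have g₀ : g 0 + g 1 + g 2 + g 3 = 0 := by
    refine (mul_eq_zero.1 ?_).resolve_left (mul_ne_zero hr2 m₀)
    linear_combination r₁ + r₂ + r₃ + r₄
  have g₁ : g 0 + g 1 - g 2 - g 3 = 0 := by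
    refine (mul_eq_zero.1 ?_).resolve_left (mul_ne_zero hr2 m₁)
    linear_combination r₁ + r₂ - r₃ - r₄
  have g₂ : g 0 - g 1 + g 2 - g 3 = 0 := by
    refine (mul_eq_zero.1 ?_).resolve_left (mul_ne_zero hr2 m₂)
    linear_combination r₁ - r₂ + r₃ - r₄
  have g₃ : g 0 - g 1 - g 2 + g 3 = 0 := by
    refine (mul_eq_zero.1 ?_).resolve_left (mul_ne_zero hr2 m₃)
    linear_combination r₁ - r₂ - r₃ + r₄
  obtain ⟨i, hi⟩ := hg0
  fin_cases i <;> simp only [Fin.zero_eta, Fin.mk_one, Fin.reduceFinMk] at hi <;>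
    exact hi (by linarith)

/-! ### Five points -/

/-- `f p x y` stands for an angle at `p`. The ten triangle sums make the twenty perimeters add up
to `20 π`, which forces equality in each of them. -/
theorem perimeter_eq_pi_of_five {ι : Type*} (f : ι → ι → ι → ℝ)
    (triangle : ∀ x y z, x ≠ y → x ≠ z → y ≠ z → f x y z + f y x z + f z x y = Real.pi)
    (perimeter : ∀ p x y z, x ≠ p → y ≠ p → z ≠ p → f p x y + f p y z + f p x z ≤ Real.pi)
    {p q r s t : ι} (pq : p ≠ q) (pr : p ≠ r) (ps : p ≠ s) (pt : p ≠ t) (qr : q ≠ r) (qs : q ≠ s)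
    (qt : q ≠ t) (rs : r ≠ s) (rt : r ≠ t) (st : s ≠ t) :
    (f p q r + f p r s + f p q s = Real.pi ∧ f p q r + f p r t + f p q t = Real.pi) ∧
      f p q s + f p s t + f p q t = Real.pi ∧ f p r s + f p s t + f p r t = Real.pi := by
  have t1 := triangle p q r pq pr qr
  have t2 := triangle p q s pq ps qs
  have t3 := triangle p q t pq pt qt
  have t4 := triangle p r s pr ps rs
  have t5 := triangle p r t pr pt rt
  have t6 := triangle p s t ps pt st
  have t7 := triangle q r s qr qs rs
  have t8 := triangle q r t qr qt rt
  have t9 := triangle q s t qs qt st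
  have t10 := triangle r s t rs rt st
  have p1 := perimeter p q r s pq.symm pr.symm ps.symm
  have p2 := perimeter p q r t pq.symm pr.symm pt.symm
  have p3 := perimeter p q s t pq.symm ps.symm pt.symm
  have p4 := perimeter p r s t pr.symm ps.symm pt.symm
  have q1 := perimeter q p r s pq qr.symm qs.symm
  have q2 := perimeter q p r t pq qr.symm qt.symm
  have q3 := perimeter q p s t pq qs.symm qt.symm
  have q4 := perimeter q r s t qr.symm qs.symm qt.symm
  have r1 := perimeter r p q s pr qr rs.symm
  have r2 := perimeter r p q t pr qr rt.symm
  have r3 := perimeter r p s t pr rs.symm rt.symm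
  have r4 := perimeter r q s t qr rs.symm rt.symm
  have s1 := perimeter s p q r ps qs rs
  have s2 := perimeter s p q t ps qs st.symm
  have s3 := perimeter s p r t ps rs st.symm
  have s4 := perimeter s q r t qs rs st.symm
  have u1 := perimeter t p q r pt qt rt
  have u2 := perimeter t p q s pt qt st
  have u3 := perimeter t p r s pt rt st
  have u4 := perimeter t q r s qt rt st
  refine ⟨⟨?_, ?_⟩, ?_, ?_⟩ <;> refine le_antisymm (by assumption) (by linarith)

theorem comparisonAngle_ne_pi_div_two_of_dist_le {A : Type*} [MetricSpace A] {p q r : A}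
    (hq : q ≠ p) (hr : r ≠ p) (h : dist q r ≤ dist p q) :
    comparisonAngle p q r ≠ Real.pi / 2 := by
  intro heq
  have hpq : 0 < dist p q := dist_pos.2 hq.symm
  have hpr : 0 < dist p r := dist_pos.2 hr.symm
  rw [comparisonAngle, Real.arccos_eq_pi_div_two, div_eq_zero_iff] at heq
  have h2 : dist q r ^ 2 ≤ dist p q ^ 2 := by gcongr
  rcases heq with heq | heq
  · nlinarith
  · exact (by positivity : 2 * dist p q * dist p r ≠ 0) heq

theorem mainTheorem8 (A : Type*) [MetricSpace A] (hA : IsNonnegativelyCurvedAlexandrov A)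
    (hdim : dimH (Set.univ : Set A) = 3) :
    {p : A | NotLargerThanSphere (SpaceOfDirections p) (1 / 2)}.encard ≤ 4 := by
  classical
  by_contra! hlt
  set S := {p : A | NotLargerThanSphere (SpaceOfDirections p) (1 / 2)}
  obtain ⟨T, hTS, hT⟩ := Set.exists_subset_encard_eq (Order.add_one_le_of_lt hlt)
  have hfin : T.Finite := Set.finite_of_encard_eq_coe (k := 5) (by rw [hT]; rfl)
  lift T to Finset A using hfin
  have hcard : T.card = 5 := by
    rw [Set.encard_coe_eq_coe_finsetCard] at hT
    exact_mod_cast hT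
  -- `p` and `q` realize the diameter of the five points.
  obtain ⟨⟨p, q⟩, hpq, hmax⟩ := T.offDiag.exists_max_image (fun z => dist z.1 z.2)
    (Finset.card_pos.1 (by rw [Finset.offDiag_card, hcard]; norm_num))
  obtain ⟨hp, hq, pq⟩ := Finset.mem_offDiag.1 hpq
  have hcard' : ((T.erase p).erase q).card = 3 := by
    rw [Finset.card_erase_of_mem (Finset.mem_erase.2 ⟨Ne.symm pq, hq⟩),
      Finset.card_erase_of_mem hp, hcard]
  obtain ⟨r, s, t, rs, rt, st, hrst⟩ := Finset.card_eq_three.1 hcard'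
  have hmem : ∀ x ∈ ({r, s, t} : Finset A), q ≠ x ∧ p ≠ x ∧ x ∈ T := by
    intro x hx
    rw [← hrst, Finset.mem_erase, Finset.mem_erase] at hx
    exact ⟨hx.1.symm, hx.2.1.symm, hx.2.2⟩
  obtain ⟨qr, pr, hr⟩ := hmem r (by simp)
  obtain ⟨qs, ps, hs⟩ := hmem s (by simp)
  obtain ⟨qt, pt, ht⟩ := hmem t (by simp)
  have hperim : ∀ p x y z : S, x ≠ p → y ≠ p → z ≠ p →
      comparisonAngle (p : A) x y + comparisonAngle (p : A) y z + comparisonAngle (p : A) x z ≤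
        Real.pi := by
    intro p x y z hx hy hz
    obtain ⟨u, -, hu⟩ := exists_comparisonAngle_le_of_notLargerThanSphere hA p.2
    let x' : {a : A // a ≠ p} := ⟨x, Subtype.coe_injective.ne hx⟩
    let y' : {a : A // a ≠ p} := ⟨y, Subtype.coe_injective.ne hy⟩
    let z' : {a : A // a ≠ p} := ⟨z, Subtype.coe_injective.ne hz⟩
    linarith [hu x' y', hu y' z', hu x' z',
      angle_add_angle_add_angle_le_two_pi (u x') (u y') (u z')]
  have hne : ∀ {x y : A} (hx : x ∈ S) (hy : y ∈ S), x ≠ y → (⟨x, hx⟩ : S) ≠ ⟨y, hy⟩ :=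
    fun _ _ h h' => h (congrArg Subtype.val h')
  obtain ⟨⟨e₁, e₂⟩, e₃, e₄⟩ := perimeter_eq_pi_of_five
    (fun p x y : S => comparisonAngle (p : A) x y)
    (fun x y z hxy hxz _ => comparisonAngle_add_comparisonAngle_add_comparisonAngle
      (Subtype.coe_injective.ne hxy) (Subtype.coe_injective.ne hxz)) hperim
    (hne (hTS hp) (hTS hq) pq) (hne (hTS hp) (hTS hr) pr) (hne (hTS hp) (hTS hs) ps)
    (hne (hTS hp) (hTS ht) pt) (hne (hTS hq) (hTS hr) qr) (hne (hTS hq) (hTS hs) qs)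
    (hne (hTS hq) (hTS ht) qt) (hne (hTS hr) (hTS hs) rs) (hne (hTS hr) (hTS ht) rt)
    (hne (hTS hs) (hTS ht) st)
  simp only at e₁ e₂ e₃ e₄
  obtain ⟨u, hnorm, hu⟩ := exists_comparisonAngle_le_of_notLargerThanSphere hA (hTS hp)
  let q' : {a : A // a ≠ p} := ⟨q, Ne.symm pq⟩
  let r' : {a : A // a ≠ p} := ⟨r, pr.symm⟩
  let s' : {a : A // a ≠ p} := ⟨s, ps.symm⟩
  let t' : {a : A // a ≠ p} := ⟨t, pt.symm⟩
  have a₁ := hu q' r'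
  have a₂ := hu q' s'
  have a₃ := hu q' t'
  have a₄ := hu r' s'
  have a₅ := hu r' t'
  have a₆ := hu s' t'
  have b₁ := angle_add_angle_add_angle_le_two_pi (u q') (u r') (u s')
  have b₂ := angle_add_angle_add_angle_le_two_pi (u q') (u r') (u t')
  have b₃ := angle_add_angle_add_angle_le_two_pi (u q') (u s') (u t')
  have b₄ := angle_add_angle_add_angle_le_two_pi (u r') (u s') (u t')
  simp only [q', r', s', t'] at a₁ a₂ a₃ a₄ a₅ a₆ b₁ b₂ b₃ b₄
  have hright : ∀ {x : A}, x ∈ T → q ≠ x → p ≠ x → comparisonAngle p q x ≠ Real.pi / 2 :=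
    fun hx hqx hpx => comparisonAngle_ne_pi_div_two_of_dist_le (Ne.symm pq) hpx.symm
      (hmax (q, _) (Finset.mem_offDiag.2 ⟨hq, hx, hqx⟩))
  rcases exists_angle_eq_pi_of_perimeters (by norm_num) (hnorm q') (hnorm r') (hnorm s')
    (hnorm t') (le_antisymm b₁ (by linarith)) (le_antisymm b₂ (by linarith))
    (le_antisymm b₃ (by linarith)) (le_antisymm b₄ (by linarith)) with h | h | h
  · exact hright hr qr pr (by simp only [q', r'] at h; linarith)
  · exact hright hs qs ps (by simp only [q', s'] at h; linarith)
  · exact hright ht qt pt (by simp only [q', t'] at h; linarith)
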